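/- Write $x\sim y$ for $x,y\in\mathbb Z^d$ with $|x-y|=1$, where $|\cdot|$ is the Euclidean norm. A time-dependent environment is a measurable map $t\mapsto\omega_t$ from $\mathbb R$ to the space of functions $v:\mathbb Z^d\times\mathbb Z^d\to[0,\infty)$ with $v(x,y)=0$ if $x\not\sim y$ (with the product $\sigma$-field). For $\kappa\in(0,1)$ let $\Omega_\kappa$ be the set of environments $\omega$ that are balanced, $\sum_{y}\omega_t(x,y)(y-x)=0$ for all $t\in\mathbb R$, $x\in\mathbb Z^d$, and uniformly elliptic with constant $\kappa$, $\omega_t(x,y)\in[\kappa,1/\kappa]$ for all $t\in\mathbb R$, $x\sim y$. For $\omega\in\Omega_\kappa$ let $P_\omega^{0,0}$ be the law of the continuous-time Markov chain $(X_s,T_s)_{s\ge0}$ on $\mathbb Z^d\times\mathbb R$, started at $(0,0)$, with generator $$\mathcal L_\omega u(x,t)=\sum_{y\sim x}\omega_t(x,y)\,(u(y,t)-u(x,t))+\partial_t u(x,t),$$ that is, of a càdlàg adapted process such that $u(X_s,T_s)-\int_0^s\mathcal L_\omega u(X_a,T_a)\,da$ is a martingale for every bounded $u:\mathbb Z^d\times\mathbb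 R\to\mathbb R$ that is $C^1$ in time with bounded time derivative. **Theorem 6.1 (fluctuation).** For every dimension $d$ and every $\kappa\in(0,1)$ there are constants $C,c>0$, depending only on $d$ and $\kappa$, such that for all $\omega\in\Omega_\kappa$, all $t>0$ and all $r\ge0$, $$P_\omega^{0,0}\Big(\sup_{0\le s\le t}|X_s|>r\Big)\le Ce^{-cr}+Ce^{-cr^2/t}.$$ -/

import Mathlib

open MeasureTheory ProbabilityTheory Filter Topology
open scoped NNReal ENNReal

namespace BalancedRW

/-- The inclusion of the lattice `ℤ^d` into Euclidean space `ℝ^d`. -/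
noncomputable def toEuc {d : ℕ} (x : Fin d → ℤ) : EuclideanSpace ℝ (Fin d) :=
  WithLp.toLp 2 (fun i => (x i : ℝ))

/-- The relation `x ∼ y`, that is `|x - y| = 1` for the Euclidean norm. -/
def Neighbor {d : ℕ} (x y : Fin d → ℤ) : Prop := ‖toEuc x - toEuc y‖ = 1

/-- The finite set of the lattice points `x ± e_i`; by `mem_neighbors` these are exactly
the points `y` with `x ∼ y`. -/
def neighbors {d : ℕ} (x : Fin d → ℤ) : Finset (Fin d → ℤ) :=
  (Finset.univ.image fun i => x + Pi.single i 1) ∪ (Finset.univ.image fun i => x - Pi.single i 1)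

theorem neighbor_iff_sum {d : ℕ} (x y : Fin d → ℤ) :
    Neighbor x y ↔ ∑ i, (x i - y i) ^ 2 = 1 := by
  unfold Neighbor toEuc
  rw [EuclideanSpace.norm_eq, Real.sqrt_eq_one, ← @Int.cast_inj ℝ]
  simp

theorem mem_neighbors {d : ℕ} (x y : Fin d → ℤ) : y ∈ neighbors x ↔ Neighbor x y := by
  rw [neighbor_iff_sum]
  constructor
  · intro h
    simp only [neighbors, Finset.mem_union, Finset.mem_image, Finset.mem_univ, true_and] at h
    rcases h with ⟨i, rfl⟩ | ⟨i, rfl⟩ <;>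
      simp [Pi.single_apply]
  · intro h
    have hex : ∃ i, (x i - y i) ^ 2 ≠ 0 := by
      by_contra! hc
      simp [hc] at h
    obtain ⟨i, hi⟩ := hex
    have hsplit := Finset.add_sum_erase Finset.univ (fun j => (x j - y j) ^ 2) (Finset.mem_univ i)
    have hnn : 0 ≤ ∑ j ∈ Finset.univ.erase i, (x j - y j) ^ 2 :=
      Finset.sum_nonneg fun j _ => sq_nonneg _
    have hpos : 0 < (x i - y i) ^ 2 := lt_of_le_of_ne (sq_nonneg _) (Ne.symm hi)
    beta_reduce at hsplit
    have h1 : (x i - y i) ^ 2 = 1 := by omega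
    have h0 : ∑ j ∈ Finset.univ.erase i, (x j - y j) ^ 2 = 0 := by omega
    have hz : ∀ j, j ≠ i → y j = x j := by
      intro j hj
      have := (Finset.sum_eq_zero_iff_of_nonneg (fun j _ => sq_nonneg _)).1 h0 j (by simp [hj])
      have := pow_eq_zero_iff (two_ne_zero) |>.1 this
      omega
    simp only [neighbors, Finset.mem_union, Finset.mem_image, Finset.mem_univ, true_and]
    have h3 : x i - y i = 1 ∨ x i - y i = -1 := by
      apply sq_eq_sq_iff_eq_or_eq_neg.1
      rw [h1]; norm_num
    rcases h3 with h2 | h2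
    · right
      refine ⟨i, funext fun j => ?_⟩
      by_cases hj : j = i
      · subst hj; simp; omega
      · simp [hj, hz j hj]
    · left
      refine ⟨i, funext fun j => ?_⟩
      by_cases hj : j = i
      · subst hj; simp; omega
      · simp [hj, hz j hj]

/-- A time-dependent environment: a measurable map `t ↦ ω_t` from `ℝ` to the nearest-neighbour
transition rates on `ℤ^d`, where the space of rates carries the product σ-algebra. -/
structure Environment (d : ℕ) where
  rate : ℝ → (Fin d → ℤ) → (Fin d → ℤ) → ℝ≥0
  rate_eq_zero : ∀ t x y, ¬ Neighbor x y → rate t x y = 0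
  measurable_rate : Measurable rate

/-- `∑_y ω_t(x,y) (y - x) = 0` for all `t` and `x` (only the neighbours of `x` contribute). -/
def Environment.IsBalanced {d : ℕ} (ω : Environment d) : Prop :=
  ∀ (t : ℝ) (x : Fin d → ℤ),
    ∑ y ∈ neighbors x, (ω.rate t x y : ℝ) • (toEuc y - toEuc x) = 0

/-- `ω_t(x,y) ∈ [κ, 1/κ]` for all `t` and all `x ∼ y`. -/
def Environment.IsElliptic {d : ℕ} (ω : Environment d) (κ : ℝ) : Prop :=
  ∀ (t : ℝ) (x y : Fin d → ℤ), Neighbor x y → (ω.rate t x y : ℝ) ∈ Set.Icc κ (1 / κ)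

/-- The parabolic difference operator
`L_ω u(x,t) = ∑_{y ∼ x} ω_t(x,y) (u(y,t) - u(x,t)) + ∂_t u(x,t)`. -/
noncomputable def Environment.parabolicOp {d : ℕ} (ω : Environment d)
    (u : (Fin d → ℤ) → ℝ → ℝ) (x : Fin d → ℤ) (t : ℝ) : ℝ :=
  ∑ y ∈ neighbors x, (ω.rate t x y : ℝ) * (u y t - u x t) + deriv (u x) t

/-- The test functions: bounded functions on `ℤ^d × ℝ`, continuously differentiable in time with
bounded time derivative. -/
structure IsTestFunction {d : ℕ} (u : (Fin d → ℤ) → ℝ → ℝ) : Prop where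
  bounded : ∃ K : ℝ, ∀ x t, |u x t| ≤ K
  contDiff : ∀ x, ContDiff ℝ 1 (u x)
  bounded_deriv : ∃ K : ℝ, ∀ x t, |deriv (u x) t| ≤ K

/-- A path indexed by `[0,∞)` is càdlàg: right-continuous with left limits. -/
def IsCadlag {E : Type*} [TopologicalSpace E] (f : ℝ≥0 → E) : Prop :=
  ∀ s, ContinuousWithinAt f (Set.Ici s) s ∧ ∃ l, Tendsto f (𝓝[<] s) (𝓝 l)

/-- `(X_s, T_s)_{s ≥ 0}` is, on the filtered probability space `(S, ℱ, P)`, a continuous-time Markov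
chain on `ℤ^d × ℝ` with generator `L_ω` and initial state `(x, t)`: it is a càdlàg adapted process
that starts at `(x, t)` and solves the martingale problem for `L_ω`, i.e.
`u(X_s, T_s) - ∫_0^s L_ω u(X_a, T_a) da` is a martingale for every test function `u`.
Its law is the quenched law `P_ω^{x,t}`. (Used for environments with bounded rates, for which
`L_ω u` is bounded and the martingale problem is well posed.) -/
structure IsWalk {d : ℕ} (ω : Environment d) (x : Fin d → ℤ) (t : ℝ)
    {S : Type*} [MeasurableSpace S] (P : Measure S) (ℱ : Filtration ℝ≥0 ‹MeasurableSpace S›)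
    (X : ℝ≥0 → S → (Fin d → ℤ)) (T : ℝ≥0 → S → ℝ) : Prop where
  adapted_X : Adapted ℱ X
  adapted_T : Adapted ℱ T
  cadlag_X : ∀ w, IsCadlag (fun s => X s w)
  cadlag_T : ∀ w, IsCadlag (fun s => T s w)
  initial : ∀ᵐ w ∂P, X 0 w = x ∧ T 0 w = t
  martingale : ∀ u : (Fin d → ℤ) → ℝ → ℝ, IsTestFunction u →
    Martingale (fun (s : ℝ≥0) w =>
      u (X s w) (T s w) -
        ∫ a in (0 : ℝ)..s, ω.parabolicOp u (X a.toNNReal w) (T a.toNNReal w)) ℱ P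

end BalancedRW

/-! This is a Chernoff bound. Balance cancels the first-order part of the generator, so on `e^{l
x_i}` with `|l| ≤ 1` it acts as a second difference, bounded by `K l² e^{l x_i}` with `K =
2(d+1)/κ`. Hence `e^{-K l² s} e^{l X^i_s}` should be a supermartingale, and Doob's inequality bounds
the probability that `l X^i` reaches `l a` before time `t` by `e^{K l² t - l a}`. The choice `l =
min(1, a/(2Kt))` gives `e^{-a²/(4Kt)}` for small `a` and, because `l` is capped at 1, only
`e^{-a/2}` for large `a`. A union over signed coordinates finishes the proof.

Exponentials are not bounded test functions, so they are truncated; the truncation keeps the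
differential inequality (`secondDiff_min_exp_le`, `Environment.parabolicOp_min_exp_le`). Grönwall's
inequality turns the martingale problem into the supermartingale property
(`IsWalk.setIntegral_le_mul_exp`). Doob's inequality is applied on dyadic time grids only, which
avoids hitting times; right-continuity in a discrete space recovers all times
(`IsWalk.measure_exists_ge_le`). -/

namespace BalancedRW

/-! ### Tools: joint measurability, Grönwall, Doob -/

/-- A process with measurable marginals and right-continuous paths is jointly measurable. -/
theorem measurable_uncurry_of_rightContinuous {S E : Type*} [MeasurableSpace S]
    [TopologicalSpace E] [TopologicalSpace.PseudoMetrizableSpace E] [MeasurableSpace E]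
    [BorelSpace E] {Y : ℝ≥0 → S → E} (hY : ∀ s, Measurable (Y s))
    (hc : ∀ w s, ContinuousWithinAt (fun s => Y s w) (Set.Ici s) s) :
    Measurable (Function.uncurry Y) := by
  -- Rounding up to a grid of mesh `1/(n+1)`: the values are countable, and the `+ 1` keeps them to
  -- the right of `a`, where the path is continuous.
  let q : ℕ → ℝ≥0 → ℝ≥0 := fun n a => ((⌊a * (n + 1)⌋₊ + 1 : ℕ) : ℝ≥0) / (n + 1)
  have hlow : ∀ n a, a ≤ q n a := by
    intro n a
    have := (Nat.lt_floor_add_one (a * ((n : ℝ≥0) + 1))).le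
    rw [le_div_iff₀ (by positivity)]
    push_cast
    exact this
  have hup : ∀ n a, q n a ≤ a + 1 / ((n : ℝ≥0) + 1) := by
    intro n a
    have := Nat.floor_le (zero_le (a := a * ((n : ℝ≥0) + 1)))
    rw [div_le_iff₀ (by positivity), add_mul, one_div, inv_mul_cancel₀ (by positivity)]
    push_cast
    gcongr
  have hq : ∀ a, Tendsto (fun n => q n a) atTop (𝓝[Set.Ici a] a) := by
    intro a
    refine tendsto_nhdsWithin_iff.2 ⟨?_, .of_forall fun n => hlow n a⟩
    have h0 : Tendsto (fun n : ℕ => a + 1 / ((n : ℝ≥0) + 1)) atTop (𝓝 (a + 0)) :=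
      tendsto_const_nhds.add tendsto_one_div_add_atTop_nhds_zero_nat
    rw [add_zero] at h0
    exact tendsto_of_tendsto_of_tendsto_of_le_of_le tendsto_const_nhds h0
      (fun n => hlow n a) (fun n => hup n a)
  refine measurable_of_tendsto_metrizable (f := fun n (p : ℝ≥0 × S) => Y (q n p.1) p.2) ?_ ?_
  · intro n
    have h1 : Measurable (fun p : ℕ × S => Y (((p.1 + 1 : ℕ) : ℝ≥0) / (n + 1)) p.2) :=
      measurable_from_prod_countable_right fun k => hY (((k + 1 : ℕ) : ℝ≥0) / (n + 1))
    have h2 : Measurable (fun p : ℝ≥0 × S => (⌊p.1 * (n + 1)⌋₊, p.2)) :=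
      (Nat.measurable_floor.comp (measurable_fst.mul_const _)).prodMk measurable_snd
    exact h1.comp h2
  · rw [tendsto_pi_nhds]
    rintro ⟨a, w⟩
    exact (hc w a).tendsto.comp (hq a)

/-- Grönwall's inequality in integral form for a bounded right-continuous function. -/
theorem le_mul_exp_of_le_add_integral {m : ℝ → ℝ} {θ B s t : ℝ} (hm : Measurable m)
    (hB : ∀ u, |m u| ≤ B) (hc : ∀ u, s ≤ u → ContinuousWithinAt m (Set.Ici u) u) (hθ : 0 ≤ θ)
    (hst : s ≤ t) (h : ∀ u, s ≤ u → m u ≤ m s + θ * ∫ a in s..u, m a) :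
    m t ≤ m s * Real.exp (θ * (t - s)) := by
  have hint : ∀ a b, IntervalIntegrable m volume a b := fun a b =>
    (intervalIntegrable_const (c := B)).mono_fun hm.aestronglyMeasurable
      (.of_forall fun u => by
        simpa using (hB u).trans (le_abs_self B))
  have hcont : Continuous fun u => m s + θ * ∫ a in s..u, m a :=
    continuous_const.add (continuous_const.mul (intervalIntegral.continuous_primitive hint s))
  -- `m` itself need not be continuous, so Grönwall is applied to its continuous majorant, whose
  -- right derivative is `θ * m`.
  have key := le_gronwallBound_of_liminf_deriv_right_le (f := fun u => m s + θ * ∫ a in s..u, m a)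
    (f' := fun u => θ * m u) (δ := m s) (K := θ) (ε := 0) (a := s) (b := t)
    hcont.continuousOn ?_ (by simp) ?_ t ⟨hst, le_rfl⟩
  · rw [gronwallBound_ε0] at key
    exact (h t hst).trans key
  · intro x hx r hr
    have hd : HasDerivWithinAt (fun u => ∫ a in s..u, m a) (m x) (Set.Ici x) x :=
      intervalIntegral.integral_hasDerivWithinAt_right (hint s x)
        hm.stronglyMeasurable.stronglyMeasurableAtFilter
        ((hc x hx.1).mono Set.Ioi_subset_Ici_self)
    exact ((hd.const_mul θ).const_add (m s)).liminf_right_slope_le hr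
  · intro x hx
    rw [add_zero]
    exact mul_le_mul_of_nonneg_left (h x hx.1) hθ

/-- Doob's maximal inequality for a nonnegative discrete-time supermartingale. -/
theorem mul_measureReal_exists_ge_le {S : Type*} [MeasurableSpace S] {P : Measure S}
    [IsFiniteMeasure P] {G : Filtration ℕ ‹MeasurableSpace S›} {Z : ℕ → S → ℝ} (hZ : Adapted G Z)
    (hi : ∀ k, Integrable (Z k) P) (h0 : ∀ k w, 0 ≤ Z k w)
    (hle : ∀ k A, MeasurableSet[G k] A → ∫ w in A, Z (k + 1) w ∂P ≤ ∫ w in A, Z k w ∂P)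
    (c : ℝ) (n : ℕ) :
    c * P.real {w | ∃ k ≤ n, c ≤ Z k w} ≤ ∫ w, Z 0 w ∂P := by
  have hE : ∀ k, MeasurableSet[G k] {w | c ≤ Z k w} := fun k =>
    hZ k measurableSet_Ici
  have hset : ∀ n, {w | ∃ k ≤ n, c ≤ Z k w} = ⋃ k ≤ n, {w | c ≤ Z k w} := fun n => by
    ext; simp
  have hB : ∀ n, MeasurableSet[G n] {w | ∃ k ≤ n, c ≤ Z k w} := fun n => by
    rw [hset]
    exact MeasurableSet.biUnion (Set.to_countable _) fun k hk => G.mono hk _ (hE k)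
  have hstep : ∀ k A, MeasurableSet A → c * P.real (A ∩ {w | c ≤ Z k w}) +
      ∫ w in A \ {w | c ≤ Z k w}, Z k w ∂P ≤ ∫ w in A, Z k w ∂P := by
    intro k A hA
    refine (add_le_add ?_ le_rfl).trans_eq
      (integral_inter_add_sdiff (s := A) (G.le k _ (hE k)) (hi k).integrableOn)
    rw [mul_comm, ← smul_eq_mul, ← setIntegral_const]
    refine setIntegral_mono_on (integrableOn_const (by finiteness)) (hi k).integrableOn
      (hA.inter (G.le k _ (hE k))) fun w hw => hw.2
  -- Keeping the mass of `Z n` on the paths still below `c` makes the induction close; it replaces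
  -- stopping at the first passage.
  suffices H : c * P.real {w | ∃ k ≤ n, c ≤ Z k w} +
      ∫ w in {w | ∃ k ≤ n, c ≤ Z k w}ᶜ, Z n w ∂P ≤ ∫ w, Z 0 w ∂P from
    le_trans (le_add_of_nonneg_right (integral_nonneg fun w => h0 n w)) H
  induction n with
  | zero =>
    have := hstep 0 Set.univ .univ
    simpa [Set.compl_eq_univ_sdiff] using this
  | succ n ih =>
    refine le_trans ?_ ih
    have h1 := hle n _ (hB n).compl
    have h2 := hstep (n + 1) _ (G.le n _ (hB n)).compl
    have h3 : {w | ∃ k ≤ n + 1, c ≤ Z k w} = {w | ∃ k ≤ n, c ≤ Z k w} ∪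
        ({w | ∃ k ≤ n, c ≤ Z k w}ᶜ ∩ {w | c ≤ Z (n + 1) w}) := by
      rw [Set.union_inter_distrib_left, Set.union_compl_self, Set.univ_inter]
      ext w
      simp only [Set.mem_ofPred_eq, Set.mem_union, Nat.le_add_one_iff, or_and_right, exists_or,
        exists_eq_left]
    have h4 : {w | ∃ k ≤ n + 1, c ≤ Z k w}ᶜ =
        {w | ∃ k ≤ n, c ≤ Z k w}ᶜ \ {w | c ≤ Z (n + 1) w} := by
      ext w
      simp only [Set.mem_ofPred_eq, Set.mem_compl_iff, Set.mem_sdiff, Nat.le_add_one_iff,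
        or_and_right, exists_or, exists_eq_left, not_or]
    rw [h4, h3, measureReal_union (by
      exact Set.disjoint_left.2 fun w hw hw' => hw'.1 hw)
      ((G.le n _ (hB n)).compl.inter (G.le (n + 1) _ (hE (n + 1)))), mul_add]
    linarith

/-! ### The generator on truncated exponentials -/

/-- Truncated exponentials have second differences controlled by their values. -/
theorem secondDiff_min_exp_le {l c : ℝ} (hl : |l| ≤ 1) (hc : 0 ≤ c) (z : ℝ) :
    min (Real.exp (l * (z + 1))) c + min (Real.exp (l * (z - 1))) c
      - 2 * min (Real.exp (l * z)) c ≤ 2 * l ^ 2 * min (Real.exp (l * z)) c := by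
  -- Uses `cosh l ≤ e^{l²/2}` and `|e^u - 1| ≤ 2|u|` for `|u| ≤ 1`.
  have hcosh : Real.exp l + Real.exp (-l) - 2 ≤ 2 * l ^ 2 := by
    have h1 := Real.cosh_le_exp_half_sq l
    have h2 : l ^ 2 ≤ 1 := (sq_le_one_iff_abs_le_one l).2 hl
    have h3 := (le_abs_self _).trans (Real.abs_exp_sub_one_le (x := l ^ 2 / 2)
      (by rw [abs_of_nonneg (by positivity)]; linarith))
    rw [abs_of_nonneg (by positivity)] at h3
    rw [Real.cosh_eq] at h1
    linarith
  rcases le_total (Real.exp (l * z)) c with h | h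
  · rw [min_eq_left h]
    have h1 : Real.exp (l * (z + 1)) = Real.exp (l * z) * Real.exp l := by
      rw [← Real.exp_add]; ring_nf
    have h2 : Real.exp (l * (z - 1)) = Real.exp (l * z) * Real.exp (-l) := by
      rw [← Real.exp_add]; ring_nf
    have h3 := min_le_left (Real.exp (l * (z + 1))) c
    have h4 := min_le_left (Real.exp (l * (z - 1))) c
    have h5 := mul_le_mul_of_nonneg_left hcosh (Real.exp_pos (l * z)).le
    rw [h1] at h3
    rw [h2] at h4
    rw [h1, h2]
    linarith
  -- At a truncated point the function is at its maximum `c`, so the second difference is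
  -- nonpositive.
  · rw [min_eq_right h]
    have h3 := min_le_right (Real.exp (l * (z + 1))) c
    have h4 := min_le_right (Real.exp (l * (z - 1))) c
    have : 0 ≤ 2 * l ^ 2 * c := by positivity
    linarith

theorem neighbors_sub_mem {d : ℕ} {x y : Fin d → ℤ} (h : y ∈ neighbors x) (i : Fin d) :
    y i = x i ∨ y i = x i + 1 ∨ y i = x i - 1 := by
  simp only [neighbors, Finset.mem_union, Finset.mem_image, Finset.mem_univ, true_and] at h
  rcases h with ⟨j, rfl⟩ | ⟨j, rfl⟩ <;> by_cases hj : i = j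
  · subst hj; simp
  · simp [hj]
  · subst hj; simp
  · simp [hj]

theorem card_neighbors_le {d : ℕ} (x : Fin d → ℤ) : (neighbors x).card ≤ 2 * d := by
  refine (Finset.card_union_le _ _).trans ?_
  have h1 := Finset.card_image_le (s := Finset.univ) (f := fun i => x + Pi.single i (1 : ℤ))
  have h2 := Finset.card_image_le (s := Finset.univ) (f := fun i => x - Pi.single i (1 : ℤ))
  simp only [Finset.card_univ, Fintype.card_fin] at h1 h2
  omega

theorem Environment.parabolicOp_const_time {d : ℕ} (ω : Environment d) (f : (Fin d → ℤ) → ℝ)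
    (x : Fin d → ℤ) (t : ℝ) : ω.parabolicOp (fun y _ => f y) x t =
      ∑ y ∈ neighbors x, (ω.rate t x y : ℝ) * (f y - f x) := by
  simp [Environment.parabolicOp]

/-- In a balanced elliptic environment the truncated exponentials of a coordinate are
`L_ω`-subsolutions up to a multiplicative constant of order `l²`. -/
theorem Environment.parabolicOp_min_exp_le {d : ℕ} {ω : Environment d} {κ : ℝ} (hκ : 0 < κ)
    (hb : ω.IsBalanced) (he : ω.IsElliptic κ) {l c : ℝ} (hl : |l| ≤ 1) (hc : 0 ≤ c) (i : Fin d)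
    (x : Fin d → ℤ) (t : ℝ) :
    ω.parabolicOp (fun y _ => min (Real.exp (l * y i)) c) x t ≤
      2 * (d + 1) / κ * l ^ 2 * min (Real.exp (l * x i)) c := by
  rw [ω.parabolicOp_const_time]
  set g : ℝ → ℝ := fun z => min (Real.exp (l * z)) c with hg
  have hg0 : 0 ≤ g (x i) := le_min (Real.exp_pos _).le hc
  have hbal : ∑ y ∈ neighbors x, (ω.rate t x y : ℝ) * ((y i : ℝ) - x i) = 0 := by
    have := congrArg (fun v : EuclideanSpace ℝ (Fin d) => v i) (hb t x)
    simpa [toEuc] using this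
  -- As `y i - x i` is `-1`, `0` or `1`, the increment of `g` splits exactly into a linear and a
  -- quadratic term in it; balance kills the linear one.
  have hterm : ∀ y ∈ neighbors x, (ω.rate t x y : ℝ) * (g (y i) - g (x i)) =
      (ω.rate t x y : ℝ) * ((y i : ℝ) - x i) * ((g (x i + 1) - g (x i - 1)) / 2) +
      (ω.rate t x y : ℝ) * ((y i : ℝ) - x i) ^ 2 *
        ((g (x i + 1) + g (x i - 1) - 2 * g (x i)) / 2) := by
    intro y hy
    rcases neighbors_sub_mem hy i with h | h | h <;> rw [h] <;> push_cast <;> ring_nf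
  rw [show (∑ y ∈ neighbors x, (ω.rate t x y : ℝ) * (min (Real.exp (l * y i)) c -
    min (Real.exp (l * x i)) c)) = _ from Finset.sum_congr rfl hterm, Finset.sum_add_distrib,
    ← Finset.sum_mul, ← Finset.sum_mul, hbal, zero_mul, zero_add]
  set Q := ∑ y ∈ neighbors x, (ω.rate t x y : ℝ) * ((y i : ℝ) - x i) ^ 2
  have hQ0 : 0 ≤ Q := Finset.sum_nonneg fun y _ => by positivity
  -- The factor `d + 1` in place of `d` keeps the constant positive when `d = 0`.
  have hQ : Q ≤ 2 * (d + 1) / κ := by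
    calc Q ≤ ∑ y ∈ neighbors x, 1 / κ := by
          refine Finset.sum_le_sum fun y hy => ?_
          have h1 := (he t x y ((mem_neighbors x y).1 hy)).2
          have h2 : ((y i : ℝ) - x i) ^ 2 ≤ 1 := by
            rcases neighbors_sub_mem hy i with h | h | h <;> rw [h] <;> push_cast <;> ring_nf <;>
              norm_num
          calc (ω.rate t x y : ℝ) * ((y i : ℝ) - x i) ^ 2 ≤ (ω.rate t x y : ℝ) * 1 := by gcongr
            _ ≤ 1 / κ := by rwa [mul_one]
      _ = (neighbors x).card * (1 / κ) := by rw [Finset.sum_const, nsmul_eq_mul]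
      _ ≤ (2 * (d + 1) : ℝ) * (1 / κ) := by
          gcongr
          have : ((neighbors x).card : ℝ) ≤ 2 * d := by exact_mod_cast card_neighbors_le x
          linarith
      _ = 2 * (d + 1) / κ := by ring
  have hD := secondDiff_min_exp_le hl hc (x i)
  calc Q * ((g (x i + 1) + g (x i - 1) - 2 * g (x i)) / 2) ≤ Q * (l ^ 2 * g (x i)) := by
        gcongr
        change g (x i + 1) + g (x i - 1) - 2 * g (x i) ≤ 2 * l ^ 2 * g (x i) at hD
        linarith
    _ ≤ 2 * (d + 1) / κ * (l ^ 2 * g (x i)) := by gcongr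
    _ = _ := by ring

/-! ### Regularity of `L_ω f` for time-independent `f` -/

theorem isTestFunction_const_time {d : ℕ} {f : (Fin d → ℤ) → ℝ} {K : ℝ} (hK : ∀ x, |f x| ≤ K) :
    IsTestFunction (fun (x : Fin d → ℤ) (_ : ℝ) => f x) where
  bounded := ⟨K, fun x _ => hK x⟩
  contDiff _ := contDiff_const
  bounded_deriv := ⟨0, fun x t => by simp⟩

theorem measurable_comp_pair {α β γ δ : Type*} [MeasurableSpace α] [MeasurableSpace β]
    [MeasurableSpace γ] [MeasurableSpace δ] {F : β → γ → δ} (hF : Measurable (Function.uncurry F))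
    {g : α → β} {h : α → γ} (hg : Measurable g) (hh : Measurable h) :
    Measurable fun a => F (g a) (h a) :=
  hF.comp (hg.prodMk hh)

theorem Environment.measurable_parabolicOp_const_time {d : ℕ} (ω : Environment d)
    (f : (Fin d → ℤ) → ℝ) :
    Measurable (Function.uncurry (ω.parabolicOp fun y _ => f y)) := by
  refine measurable_from_prod_countable_right fun x => ?_
  change Measurable fun t => ω.parabolicOp (fun y _ => f y) x t
  simp only [ω.parabolicOp_const_time]
  refine Finset.measurable_sum _ fun y _ => Measurable.mul_const ?_ _
  have := (measurable_pi_apply y).comp ((measurable_pi_apply x).comp ω.measurable_rate)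
  exact measurable_coe_nnreal_real.comp this

theorem Environment.exists_abs_parabolicOp_le {d : ℕ} {ω : Environment d} {κ : ℝ}
    (hκ : 0 < κ) (he : ω.IsElliptic κ) {f : (Fin d → ℤ) → ℝ} {K : ℝ} (hK : ∀ x, |f x| ≤ K) :
    ∃ B, ∀ x t, |ω.parabolicOp (fun y _ => f y) x t| ≤ B := by
  have hK0 : 0 ≤ K := (abs_nonneg _).trans (hK 0)
  refine ⟨(2 * d : ℕ) * (1 / κ * (K + K)), fun x t => ?_⟩
  rw [ω.parabolicOp_const_time]
  calc _ ≤ ∑ y ∈ neighbors x, |(ω.rate t x y : ℝ) * (f y - f x)| := Finset.abs_sum_le_sum_abs _ _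
    _ ≤ ∑ y ∈ neighbors x, 1 / κ * (K + K) := by
      refine Finset.sum_le_sum fun y hy => ?_
      rw [abs_mul, NNReal.abs_eq]
      gcongr
      · exact (he t x y ((mem_neighbors x y).1 hy)).2
      · exact (abs_sub _ _).trans (add_le_add (hK y) (hK x))
    _ ≤ _ := by
      rw [Finset.sum_const, nsmul_eq_mul]
      gcongr
      exact card_neighbors_le x

/-! ### Supermartingale property and maximal inequality for the walk -/

variable {d : ℕ} {ω : Environment d} {x₀ : Fin d → ℤ} {t₀ : ℝ} {S : Type*} [MeasurableSpace S]
  {P : Measure S} {ℱ : Filtration ℝ≥0 ‹MeasurableSpace S›} {X : ℝ≥0 → S → (Fin d → ℤ)}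
  {T : ℝ≥0 → S → ℝ}

theorem IsWalk.measurable_X (hw : IsWalk ω x₀ t₀ P ℱ X T) :
    Measurable fun p : ℝ × S => X p.1.toNNReal p.2 :=
  (measurable_uncurry_of_rightContinuous (fun s => (hw.adapted_X s).mono (ℱ.le s) le_rfl)
    fun w s => (hw.cadlag_X w s).1).comp (measurable_real_toNNReal.prodMap measurable_id)

theorem IsWalk.measurable_T (hw : IsWalk ω x₀ t₀ P ℱ X T) :
    Measurable fun p : ℝ × S => T p.1.toNNReal p.2 :=
  (measurable_uncurry_of_rightContinuous (fun s => (hw.adapted_T s).mono (ℱ.le s) le_rfl)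
    fun w s => (hw.cadlag_T w s).1).comp (measurable_real_toNNReal.prodMap measurable_id)

/-- If `L_ω f ≤ θ f` then `e^{-θ s} f(X_s)` is a supermartingale. -/
theorem IsWalk.setIntegral_le_mul_exp [IsProbabilityMeasure P] (hw : IsWalk ω x₀ t₀ P ℱ X T)
    {κ : ℝ} (hκ : 0 < κ) (he : ω.IsElliptic κ) {f : (Fin d → ℤ) → ℝ} {K θ : ℝ}
    (hK : ∀ x, |f x| ≤ K) (hθ : 0 ≤ θ)
    (hL : ∀ x t, ω.parabolicOp (fun y _ => f y) x t ≤ θ * f x)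
    {s t : ℝ≥0} (hst : s ≤ t) {A : Set S} (hA : MeasurableSet[ℱ s] A) :
    ∫ w in A, f (X t w) ∂P ≤ (∫ w in A, f (X s w) ∂P) * Real.exp (θ * (t - s)) := by
  have hA' : MeasurableSet A := ℱ.le s _ hA
  have hf : Measurable f := measurable_of_countable f
  have hX := hw.measurable_X
  have hT := hw.measurable_T
  have hfX : Measurable fun p : ℝ × S => f (X p.1.toNNReal p.2) := hf.comp hX
  have hLX : Measurable fun p : ℝ × S => ω.parabolicOp (fun y _ => f y)
      (X p.1.toNNReal p.2) (T p.1.toNNReal p.2) :=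
    measurable_comp_pair (ω.measurable_parabolicOp_const_time f) hX hT
  obtain ⟨B, hB⟩ := ω.exists_abs_parabolicOp_le hκ he hK
  have hiL : ∀ w a b, IntervalIntegrable (fun a : ℝ => ω.parabolicOp (fun y _ => f y)
      (X a.toNNReal w) (T a.toNNReal w)) volume a b := fun w a b =>
    (intervalIntegrable_const (c := B)).mono_fun
      (hLX.comp (measurable_id.prodMk measurable_const)).aestronglyMeasurable
      (.of_forall fun u => by simpa using (hB _ _).trans (le_abs_self B))
  have hif : ∀ w a b, IntervalIntegrable (fun a : ℝ => f (X a.toNNReal w)) volume a b :=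
    fun w a b => (intervalIntegrable_const (c := K)).mono_fun
      (hfX.comp (measurable_id.prodMk measurable_const)).aestronglyMeasurable
      (.of_forall fun u => by simpa using (hK _).trans (le_abs_self K))
  have hifX : ∀ a : ℝ≥0, Integrable (fun w => f (X a w)) P := fun a =>
    .of_bound (hf.comp ((hw.adapted_X a).mono (ℱ.le a) le_rfl)).aestronglyMeasurable K
      (.of_forall fun w => hK _)
  set m : ℝ → ℝ := fun a => ∫ w in A, f (X a.toNNReal w) ∂P with hm
  have hswap : ∀ a b : ℝ, Integrable (Function.uncurry fun (a : ℝ) w => f (X a.toNNReal w))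
      ((volume.restrict (Set.uIoc a b)).prod (P.restrict A)) := fun a b =>
    have : IsFiniteMeasure (volume.restrict (Set.uIoc a b)) :=
      inferInstanceAs (IsFiniteMeasure (volume.restrict (Set.Ioc (min a b) (max a b))))
    .of_bound hfX.aestronglyMeasurable K (.of_forall fun p => hK _)
  have key := le_mul_exp_of_le_add_integral (m := m) (θ := θ) (B := K) (s := s) (t := t)
    ?_ ?_ ?_ hθ (by exact_mod_cast hst) ?_
  · simpa [hm] using key
  · exact hfX.stronglyMeasurable.integral_prod_right'.measurable
  · intro u
    have h := norm_setIntegral_le_of_norm_le_const (μ := P) (s := A)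
      (f := fun w => f (X u.toNNReal w)) (C := K) (by finiteness) fun w _ => hK _
    refine h.trans ?_
    have hK0 : 0 ≤ K := (abs_nonneg _).trans (hK 0)
    exact mul_le_of_le_one_right hK0 measureReal_le_one
  · intro u _
    refine continuousWithinAt_of_dominated (bound := fun _ => K)
      (.of_forall fun a => (hifX _).aestronglyMeasurable.restrict)
      (.of_forall fun a => .of_forall fun w => hK _) (integrable_const _) (.of_forall fun w => ?_)
    have h1 : ContinuousWithinAt (fun a : ℝ => X a.toNNReal w) (Set.Ici u) u :=
      ((hw.cadlag_X w u.toNNReal).1).comp (f := Real.toNNReal)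
        continuous_real_toNNReal.continuousWithinAt fun a ha => Real.toNNReal_mono ha
    exact (continuous_of_discreteTopology (f := f)).continuousAt.comp_continuousWithinAt h1
  · intro u hu
    lift u to ℝ≥0 using s.2.trans hu
    have hsu : s ≤ u := by exact_mod_cast hu
    have hM := hw.martingale _ (isTestFunction_const_time hK)
    -- The time integral is the difference of `f(X)` and the martingale, both integrable.
    have hJ : ∀ a : ℝ≥0, Integrable (fun w => ∫ a in (0 : ℝ)..a, ω.parabolicOp (fun y _ => f y)
        (X a.toNNReal w) (T a.toNNReal w)) P := fun a =>
      ((hifX a).sub (hM.integrable a)).congr (.of_forall fun w => by simp)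
    have h1 := hM.setIntegral_eq hsu hA
    rw [integral_sub (hifX _).integrableOn (hJ _).integrableOn,
      integral_sub (hifX _).integrableOn (hJ _).integrableOn] at h1
    -- Fubini, after `L_ω f ≤ θ f` is used under the time integral.
    have h2 : ∫ w in A, (∫ a in (0 : ℝ)..u, ω.parabolicOp (fun y _ => f y)
          (X a.toNNReal w) (T a.toNNReal w)) ∂P -
        ∫ w in A, (∫ a in (0 : ℝ)..s, ω.parabolicOp (fun y _ => f y)
          (X a.toNNReal w) (T a.toNNReal w)) ∂P ≤ θ * ∫ a in (s : ℝ)..u, m a := by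
      rw [← integral_sub (hJ _).integrableOn (hJ _).integrableOn,
        intervalIntegral_integral_swap (hswap s u), ← integral_const_mul]
      refine integral_mono ((hJ u).sub (hJ s)).integrableOn ?_ fun w => ?_
      · refine Integrable.const_mul ?_ θ
        have := (hswap s u).integral_prod_right
        simpa [intervalIntegral.integral_of_le hu, Set.uIoc_of_le hu] using this
      · change _ - _ ≤ θ * _
        rw [intervalIntegral.integral_interval_sub_left (hiL _ _ _) (hiL _ _ _),
          ← intervalIntegral.integral_const_mul]
        exact intervalIntegral.integral_mono_on hu (hiL _ _ _) ((hif _ _ _).const_mul θ)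
          fun a _ => hL _ _
    simp only [hm, Real.toNNReal_coe]
    simp only [hm] at h2
    linarith

/-- Maximal inequality: if `L_ω f ≤ θ f`, then `f(X)` reaches the level `c` before time `t` with
probability at most `e^{θ t} f(x₀) / c`. -/
theorem IsWalk.measure_exists_ge_le [IsProbabilityMeasure P] (hw : IsWalk ω x₀ t₀ P ℱ X T)
    {κ : ℝ} (hκ : 0 < κ) (he : ω.IsElliptic κ) {f : (Fin d → ℤ) → ℝ} {K θ : ℝ}
    (h0 : ∀ x, 0 ≤ f x) (hK : ∀ x, |f x| ≤ K) (hθ : 0 ≤ θ)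
    (hL : ∀ x t, ω.parabolicOp (fun y _ => f y) x t ≤ θ * f x) {c : ℝ} (hc : 0 < c) (t : ℝ≥0) :
    P {w | ∃ s ≤ t, c ≤ f (X s w)} ≤ ENNReal.ofReal (Real.exp (θ * t) * f x₀ / c) := by
  have hf : Measurable f := measurable_of_countable f
  have hifX : ∀ a : ℝ≥0, Integrable (fun w => f (X a w)) P := fun a =>
    .of_bound (hf.comp ((hw.adapted_X a).mono (ℱ.le a) le_rfl)).aestronglyMeasurable K
      (.of_forall fun w => hK _)
  -- The level is reached at a point of the dyadic grid of `[0, t]`; these events increase with `n`.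
  let E : ℕ → Set S := fun n => {w | ∃ k : ℕ, k ≤ 2 ^ n ∧ c ≤ f (X (k * t / 2 ^ n) w)}
  have hmono : Monotone E := by
    refine monotone_nat_of_le_succ fun n w => ?_
    rintro ⟨k, hk, hkc⟩
    refine ⟨2 * k, by rw [pow_succ]; omega, ?_⟩
    convert hkc using 3
    rw [pow_succ, mul_comm _ (2 : ℝ≥0)]
    push_cast
    rw [mul_assoc, mul_div_mul_left _ _ two_ne_zero]
  have hsub : {w | ∃ s ≤ t, c ≤ f (X s w)} ⊆ ⋃ n, E n := by
    rintro w ⟨s, hs, hsc⟩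
    rcases eq_or_ne t 0 with rfl | ht
    · refine Set.mem_iUnion.2 ⟨0, 0, by simp, ?_⟩
      obtain rfl : s = 0 := le_antisymm hs zero_le
      simpa using hsc
    have htpos : 0 < t := pos_iff_ne_zero.2 ht
    -- The state space is discrete, so a right-continuous path stays put for a short time after `s`,
    -- long enough to meet a fine grid.
    have hX : ∀ᶠ a in 𝓝[≥] s, X a w = X s w :=
      (hw.cadlag_X w s).1.tendsto.eventually_mem ((isOpen_discrete {X s w}).mem_nhds rfl)
    let q : ℕ → ℝ≥0 := fun n => ⌈s * 2 ^ n / t⌉₊ * t / 2 ^ n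
    have hlow : ∀ n, s ≤ q n := fun n => by
      rw [le_div_iff₀ (by positivity), ← div_le_iff₀ htpos]
      exact Nat.le_ceil _
    have hup : ∀ n, q n ≤ s + t * (1 / 2) ^ n := fun n => by
      have h1 := (Nat.ceil_lt_add_one (zero_le (a := s * 2 ^ n / t))).le
      rw [div_le_iff₀ (by positivity), add_mul, mul_assoc t, ← mul_pow, one_div,
        inv_mul_cancel₀ two_ne_zero, one_pow, mul_one]
      calc _ ≤ (s * 2 ^ n / t + 1) * t := by gcongr
        _ = _ := by rw [add_mul, div_mul_cancel₀ _ ht, one_mul]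
    have hq : Tendsto q atTop (𝓝[≥] s) := by
      refine tendsto_nhdsWithin_iff.2 ⟨?_, .of_forall hlow⟩
      have h1 : Tendsto (fun n : ℕ => s + t * (1 / 2 : ℝ≥0) ^ n) atTop (𝓝 (s + t * 0)) :=
        tendsto_const_nhds.add (tendsto_const_nhds.mul
          (NNReal.tendsto_pow_atTop_nhds_zero_of_lt_one (by
            rw [← NNReal.coe_lt_coe]; norm_num)))
      rw [mul_zero, add_zero] at h1
      exact tendsto_of_tendsto_of_tendsto_of_le_of_le tendsto_const_nhds h1 hlow hup
    obtain ⟨n, hn⟩ := (hq.eventually hX).exists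
    refine Set.mem_iUnion.2 ⟨n, ⌈s * 2 ^ n / t⌉₊, ?_, ?_⟩
    · refine Nat.ceil_le.2 ?_
      rw [div_le_iff₀ htpos, mul_comm]
      push_cast
      gcongr
    · change c ≤ f (X (q n) w)
      rwa [hn]
  have hE : ∀ n, P (E n) ≤ ENNReal.ofReal (Real.exp (θ * t) * f x₀ / c) := by
    intro n
    let τ : ℕ → ℝ≥0 := fun k => k * t / 2 ^ n
    have hτ : Monotone τ := fun k j hkj => by
      simp only [τ]; gcongr
    let G : Filtration ℕ ‹MeasurableSpace S› :=
      ⟨fun k => ℱ (τ k), fun k j h => ℱ.mono (hτ h), fun k => ℱ.le _⟩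
    -- Up to time `t` the discount is at least `e^{-θt}`, hence the threshold `e^{-θt} c` below.
    let Z : ℕ → S → ℝ := fun k w => Real.exp (-(θ * τ k)) * f (X (τ k) w)
    have hdoob := mul_measureReal_exists_ge_le (G := G) (Z := Z) (P := P)
      (fun k => (hf.comp (hw.adapted_X (τ k))).const_mul _)
      (fun k => (hifX _).const_mul _) (fun k w => mul_nonneg (Real.exp_pos _).le (h0 _))
      (fun k A hA => by
        have h1 := hw.setIntegral_le_mul_exp hκ he hK hθ hL (hτ k.le_succ) hA
        simp only [Z, integral_const_mul]
        calc _ ≤ Real.exp (-(θ * τ (k + 1))) * ((∫ w in A, f (X (τ k) w) ∂P) *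
              Real.exp (θ * (τ (k + 1) - τ k))) := by gcongr
          _ = Real.exp (-(θ * τ (k + 1))) * Real.exp (θ * (τ (k + 1) - τ k)) *
              ∫ w in A, f (X (τ k) w) ∂P := by ring
          _ = _ := by rw [← Real.exp_add]; ring_nf)
      (Real.exp (-(θ * t)) * c) (2 ^ n)
    have hZ0 : ∫ w, Z 0 w ∂P = f x₀ := by
      have : Z 0 =ᵐ[P] fun _ => f x₀ := by
        filter_upwards [hw.initial] with w hw'
        simp [Z, τ, hw'.1]
      rw [integral_congr_ae this]
      simp
    have hEsub : E n ⊆ {w | ∃ k ≤ 2 ^ n, Real.exp (-(θ * t)) * c ≤ Z k w} := by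
      rintro w ⟨k, hk, hkc⟩
      refine ⟨k, hk, ?_⟩
      have hτt : τ k ≤ t := by
        simp only [τ]
        rw [div_le_iff₀ (by positivity), mul_comm]
        gcongr
        exact_mod_cast hk
      simp only [Z]
      gcongr
    rw [hZ0] at hdoob
    refine (measure_mono hEsub).trans ?_
    rw [← ofReal_measureReal]
    refine ENNReal.ofReal_le_ofReal ?_
    rw [le_div_iff₀ hc]
    calc _ = Real.exp (θ * t) * (Real.exp (-(θ * t)) * c *
          P.real {w | ∃ k ≤ 2 ^ n, Real.exp (-(θ * t)) * c ≤ Z k w}) := by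
          rw [← mul_assoc, ← mul_assoc, ← Real.exp_add, add_neg_cancel, Real.exp_zero]; ring
      _ ≤ _ := by gcongr
  calc _ ≤ P (⋃ n, E n) := measure_mono hsub
    _ ≤ _ := by
      rw [hmono.measure_iUnion]
      exact iSup_le hE

/-- Exponential bound for the running maximum of a linear functional `l X^i`. -/
theorem IsWalk.measure_exists_coord_le [IsProbabilityMeasure P] (hw : IsWalk ω 0 t₀ P ℱ X T)
    {κ : ℝ} (hκ : 0 < κ) (hb : ω.IsBalanced) (he : ω.IsElliptic κ) {l : ℝ} (hl : |l| ≤ 1)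
    (i : Fin d) (b : ℝ) (t : ℝ≥0) :
    P {w | ∃ s ≤ t, b ≤ l * X s w i} ≤
      ENNReal.ofReal (Real.exp (2 * (d + 1) / κ * l ^ 2 * t - b)) := by
  set θ := 2 * (d + 1) / κ * l ^ 2
  have hθ : 0 ≤ θ := by positivity
  have hpos := Real.exp_pos b
  -- Truncating exactly at the target level `e^b` leaves the event unchanged.
  have h := hw.measure_exists_ge_le hκ he (f := fun x => min (Real.exp (l * x i)) (Real.exp b))
    (K := Real.exp b) (θ := θ) (fun x => by positivity)
    (fun x => by rw [abs_of_nonneg (by positivity)]; exact min_le_right _ _) hθ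
    (fun x t => ω.parabolicOp_min_exp_le hκ hb he hl hpos.le i x t) hpos t
  refine (measure_mono ?_).trans (h.trans (ENNReal.ofReal_le_ofReal ?_))
  · rintro w ⟨s, hs, hsb⟩
    exact ⟨s, hs, le_min (Real.exp_le_exp.2 hsb) le_rfl⟩
  · rw [Real.exp_sub]
    gcongr
    refine mul_le_of_le_one_right (Real.exp_pos _).le ((min_le_left _ _).trans ?_)
    simp

/-! ### From coordinates to the norm, and the choice of `l` -/

theorem norm_toEuc_le (x : Fin d → ℤ) : ‖toEuc x‖ ≤ ∑ i, |(x i : ℝ)| := by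
  rw [EuclideanSpace.norm_eq]
  refine Real.sqrt_le_iff.2 ⟨Finset.sum_nonneg fun i _ => abs_nonneg _, ?_⟩
  simpa [toEuc] using Finset.sum_sq_le_sq_sum_of_nonneg (s := Finset.univ)
    (f := fun i => |(x i : ℝ)|) fun i _ => abs_nonneg _

/-- The norm is at most the sum of the `d` coordinate sizes. Dividing by `d + 1` avoids a zero
denominator when `d = 0`. -/
theorem exists_lt_abs_of_lt_norm {r : ℝ} (hr : 0 ≤ r) {x : Fin d → ℤ} (h : r < ‖toEuc x‖) :
    ∃ i, r / (d + 1) < |(x i : ℝ)| := by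
  by_contra! hc
  have h1 : ∑ i, |(x i : ℝ)| ≤ d * (r / (d + 1)) := by
    simpa using Finset.sum_le_sum fun i (_ : i ∈ Finset.univ) => hc i
  have h2 : d * (r / (d + 1)) ≤ r := by
    rw [mul_div_assoc', div_le_iff₀ (by positivity)]
    nlinarith
  linarith [norm_toEuc_le x]

/-- The exponent `K λ² t - λ a` optimised over `λ ∈ [0, 1]`. -/
theorem exists_exp_le {K a t : ℝ} (hK : 0 < K) (ha : 0 ≤ a) (ht : 0 < t) :
    ∃ l, 0 ≤ l ∧ l ≤ 1 ∧ Real.exp (K * l ^ 2 * t - l * a) ≤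
      Real.exp (-(a / 2)) + Real.exp (-(a ^ 2 / (4 * K * t))) := by
  -- The free minimiser is `a/(2Kt)`; if it exceeds 1, then `l = 1` works because `K t ≤ a/2`.
  rcases le_total a (2 * K * t) with h | h
  · refine ⟨a / (2 * K * t), by positivity, (div_le_one (by positivity)).2 h, ?_⟩
    rw [show K * (a / (2 * K * t)) ^ 2 * t - a / (2 * K * t) * a = -(a ^ 2 / (4 * K * t)) by
      field_simp; ring]
    linarith [Real.exp_pos (-(a / 2))]
  · refine ⟨1, zero_le_one, le_rfl, ?_⟩
    have : Real.exp (K * 1 ^ 2 * t - 1 * a) ≤ Real.exp (-(a / 2)) :=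
      Real.exp_le_exp.2 (by linarith)
    linarith [Real.exp_pos (-(a ^ 2 / (4 * K * t)))]

end BalancedRW

theorem theorem6p1 (d : ℕ) (κ : ℝ) (hκ : κ ∈ Set.Ioo (0 : ℝ) 1) :
    ∃ C c : ℝ, 0 < C ∧ 0 < c ∧
      ∀ ω : BalancedRW.Environment d, ω.IsBalanced → ω.IsElliptic κ →
      ∀ (S : Type*) [MeasurableSpace S] (P : Measure S) [IsProbabilityMeasure P]
        (ℱ : Filtration ℝ≥0 ‹MeasurableSpace S›)
        (X : ℝ≥0 → S → (Fin d → ℤ)) (T : ℝ≥0 → S → ℝ),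
        BalancedRW.IsWalk ω 0 0 P ℱ X T →
        ∀ t r : ℝ, 0 < t → 0 ≤ r →
          P {w | ENNReal.ofReal r <
              ⨆ (s : ℝ≥0) (_ : (s : ℝ) ≤ t), ENNReal.ofReal ‖BalancedRW.toEuc (X s w)‖} ≤
            ENNReal.ofReal
              (C * Real.exp (-(c * r)) + C * Real.exp (-(c * r ^ 2 / t))) := by
  obtain ⟨hκ0, -⟩ := hκ
  set K : ℝ := 2 * (d + 1) / κ with hKdef
  have hK : 0 < K := by positivity
  have hD : (0 : ℝ) < d + 1 := by positivity
  set c₁ : ℝ := 1 / (2 * (d + 1)) with hc₁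
  set c₂ : ℝ := 1 / (4 * K * (d + 1) ^ 2) with hc₂
  -- `2 * d` counts the signed coordinates, and `+ 1` ensures positivity when `d = 0`. The rates
  -- `c₁`, `c₂` are those of `exists_exp_le` at `a = r/(d+1)`.
  refine ⟨2 * d + 1, min c₁ c₂, by positivity, by positivity, ?_⟩
  intro ω hb he S _ P _ ℱ X T hw t r ht hr
  set a : ℝ := r / (d + 1) with ha_def
  have ha : 0 ≤ a := by positivity
  obtain ⟨l, hl0, hl1, hl⟩ := BalancedRW.exists_exp_le hK ha ht
  set b : ℝ := Real.exp (-(a / 2)) + Real.exp (-(a ^ 2 / (4 * K * t))) with hb_def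
  have hb0 : 0 ≤ b := by positivity
  lift t to ℝ≥0 using ht.le
  have hbound : ∀ σ : ℝ, |σ| = 1 → ∀ i : Fin d,
      P {w | ∃ s ≤ t, l * a ≤ σ * l * X s w i} ≤ ENNReal.ofReal b := by
    intro σ hσ i
    refine (hw.measure_exists_coord_le hκ0 hb he (l := σ * l) ?_ i (l * a) t).trans
      (ENNReal.ofReal_le_ofReal ?_)
    · rwa [abs_mul, hσ, one_mul, abs_of_nonneg hl0]
    · rwa [mul_pow, ← sq_abs σ, hσ, one_pow, one_mul]
  have hsub : {w | ENNReal.ofReal r < ⨆ (s : ℝ≥0) (_ : (s : ℝ) ≤ t),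
      ENNReal.ofReal ‖BalancedRW.toEuc (X s w)‖} ⊆
      ⋃ i : Fin d, ({w | ∃ s ≤ t, l * a ≤ 1 * l * X s w i} ∪
        {w | ∃ s ≤ t, l * a ≤ -1 * l * X s w i}) := by
    intro w hwr
    simp only [Set.mem_ofPred_eq, lt_iSup_iff] at hwr
    obtain ⟨s, hs, hsr⟩ := hwr
    obtain ⟨i, hi⟩ := BalancedRW.exists_lt_abs_of_lt_norm hr (ENNReal.ofReal_lt_ofReal_iff'.1 hsr).1
    refine Set.mem_iUnion.2 ⟨i, ?_⟩
    rcases lt_abs.1 hi with h | h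
    · exact Or.inl ⟨s, by exact_mod_cast hs, by
        rw [one_mul]; exact mul_le_mul_of_nonneg_left h.le hl0⟩
    · refine Or.inr ⟨s, by exact_mod_cast hs, ?_⟩
      have := mul_le_mul_of_nonneg_left h.le hl0
      linarith
  calc _ ≤ ∑ i : Fin d, (ENNReal.ofReal b + ENNReal.ofReal b) := by
        refine (measure_mono hsub).trans ((measure_iUnion_fintype_le _ _).trans ?_)
        refine Finset.sum_le_sum fun i _ => (measure_union_le _ _).trans ?_
        exact add_le_add (hbound 1 (by simp) i) (hbound (-1) (by simp) i)
    _ = ENNReal.ofReal (2 * d * b) := by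
        rw [← ENNReal.ofReal_add hb0 hb0, ← ENNReal.ofReal_sum_of_nonneg (fun _ _ => by positivity)]
        congr 1
        simp
        ring
    _ ≤ _ := by
        refine ENNReal.ofReal_le_ofReal ?_
        rw [← mul_add]
        have h1 : a / 2 = c₁ * r := by rw [ha_def, hc₁]; field_simp
        have h2 : a ^ 2 / (4 * K * t) = c₂ * r ^ 2 / t := by rw [ha_def, hc₂]; field_simp
        rw [hb_def, h1, h2]
        gcongr
        · linarith
        · exact min_le_left _ _
        · exact min_le_right _ _
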